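/- All normed spaces are real, and cardinal invariants are taken to be infinite: the weight $w(X)$ of a topological space is the maximum of $\aleph_0$ and the least cardinality of a base, and the density $d(X)$ is the maximum of $\aleph_0$ and the least cardinality of a dense subset. Let $E,F$ be normed spaces with closed unit balls $B_E,B_F$, and let $\omega:E\times F\to\mathbb{R}$ be bilinear. The form $\omega$ is *regular* if $|\omega(x,f)|\le\|x\|\,\|f\|$ for all $(x,f)\in E\times F$. It is a *strong duality* if for every norm-unbounded sequence $(x_n)$ in $E$ the set $\{\omega(x_n,f): n\in\mathbb{N},\ f\in B_F\}$ is unbounded in $\mathbb{R}$, and for every norm-unbounded sequence $(f_n)$ in $F$ the set $\{\omega(x,f_n): n\in\mathbb{N},\ x\in B_E\}$ is unbounded in $\mathbb{R}$. A *birepresentation* of a group $G$ in a continuous bilinear form $\omega:E\times F\to\mathbb{R}$ is a pair of homomorphisms $h_1:G\to\mathrm{Iso}(E)$, $h_2:G\to\mathrm{Iso}(F)$ into the groups of surjective linear isometries such that $\omega(h_1(g)x,h_2(g)f)=\omega(x,f)$ for all $g\in G$, $x\in E$, $f\in F$. It is *continuous* for a topology on $G$ if both actions $G\times E\to E$, $(g,x)\mapsto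 h_1(g)x$, and $G\times F\to F$, $(g,f)\mapsto h_2(g)f$, are continuous. A system $(\Phi_i)_{i\in I}$ of continuous birepresentations of a Hausdorff topological group $(G,\tau)$ in forms $\omega_i:E_i\times F_i\to\mathbb{R}$ is *t-exact* if for every strictly coarser (not necessarily Hausdorff) group topology $\tau'\subsetneq\tau$ on $G$ there is $i\in I$ such that $\Phi_i$ is not continuous for $\tau'$; a single birepresentation is t-exact if the system consisting of it alone is. A topological group is a *BR-group* if it has a t-exact system of continuous birepresentations in strong dualities. **Theorem.** Let $G$ be a Hausdorff topological group. 1. $G$ is a BR-group. 2. Moreover, there exist Banach spaces $E,F$ with $d(E)\le w(G)$ and $d(F)\le w(G)$, a regular strong duality $\omega:E\times F\to\mathbb{R}$, and a t-exact birepresentation $h_1:G\to\mathrm{Iso}(E)$, $h_2:G\to\mathrm{Iso}(F)$ of $G$ in $\omega$. -/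

import Mathlib

universe u v w

open Cardinal

/-- The weight `w(X)` of a topological space: the least cardinality of a base, where, by convention,
cardinal invariants are infinite. -/
noncomputable def topWeight (X : Type u) [TopologicalSpace X] : Cardinal.{u} :=
  max ℵ₀ (sInf {κ | ∃ B : Set (Set X), TopologicalSpace.IsTopologicalBasis B ∧ #B = κ})

/-- The density `d(X)` of a topological space: the least cardinality of a dense subset, where, by
convention, cardinal invariants are infinite. -/
noncomputable def topDensity (X : Type u) [TopologicalSpace X] : Cardinal.{u} :=
  max ℵ₀ (sInf {κ | ∃ D : Set X, Dense D ∧ #D = κ})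

section Duality

variable {E : Type v} {F : Type w} [SeminormedAddCommGroup E] [NormedSpace ℝ E]
  [SeminormedAddCommGroup F] [NormedSpace ℝ F]

/-- A bilinear form is a left strong duality if for every norm-unbounded sequence `x n` in `E` the
set of all values `ω (x n) f`, with `n : ℕ` and `f` in the closed unit ball of `F`, is unbounded. -/
def IsLeftStrongDuality (ω : E →ₗ[ℝ] F →ₗ[ℝ] ℝ) : Prop :=
  ∀ x : ℕ → E, ¬ Bornology.IsBounded (Set.range x) →
    ¬ Bornology.IsBounded {r : ℝ | ∃ (n : ℕ) (f : F), ‖f‖ ≤ 1 ∧ ω (x n) f = r}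

/-- A bilinear form is a right strong duality if for every norm-unbounded sequence `f n` in `F` the
set of all values `ω x (f n)`, with `n : ℕ` and `x` in the closed unit ball of `E`, is unbounded. -/
def IsRightStrongDuality (ω : E →ₗ[ℝ] F →ₗ[ℝ] ℝ) : Prop :=
  ∀ f : ℕ → F, ¬ Bornology.IsBounded (Set.range f) →
    ¬ Bornology.IsBounded {r : ℝ | ∃ (n : ℕ) (x : E), ‖x‖ ≤ 1 ∧ ω x (f n) = r}

/-- A strong duality is a left and right strong duality. -/
def IsStrongDuality (ω : E →ₗ[ℝ] F →ₗ[ℝ] ℝ) : Prop :=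
  IsLeftStrongDuality ω ∧ IsRightStrongDuality ω

/-- A bilinear form is regular if `|ω x f| ≤ ‖x‖ ‖f‖` for all `x` and `f`. -/
def IsRegularForm (ω : E →ₗ[ℝ] F →ₗ[ℝ] ℝ) : Prop :=
  ∀ (x : E) (f : F), |ω x f| ≤ ‖x‖ * ‖f‖

end Duality

/-- A birepresentation of a group `G`: a continuous bilinear form `ω : E × F → ℝ` on real normed
spaces together with homomorphisms of `G` into the groups of surjective linear isometries of `E`
and of `F` under which `ω` is invariant. No topology on `G` is involved yet. -/
structure Birepresentation (G : Type u) [Group G] : Type (max u (v + 1)) where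
  E : Type v
  F : Type v
  [normE : NormedAddCommGroup E]
  [spaceE : NormedSpace ℝ E]
  [normF : NormedAddCommGroup F]
  [spaceF : NormedSpace ℝ F]
  ω : E →ₗ[ℝ] F →ₗ[ℝ] ℝ
  continuous_ω : Continuous fun p : E × F => ω p.1 p.2
  h₁ : G →* (E ≃ₗᵢ[ℝ] E)
  h₂ : G →* (F ≃ₗᵢ[ℝ] F)
  invariant : ∀ (g : G) (x : E) (f : F), ω (h₁ g x) (h₂ g f) = ω x f

namespace Birepresentation

attribute [instance] normE spaceE normF spaceF

variable {G : Type u} [Group G]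

/-- The birepresentation is continuous for the topology `τ` on `G`: both actions `G × E → E` and
`G × F → F` are continuous. -/
def ContinuousFor (Φ : Birepresentation.{u, v} G) (τ : TopologicalSpace G) : Prop :=
  (Continuous fun p : G × Φ.E => Φ.h₁ p.1 p.2) ∧ (Continuous fun p : G × Φ.F => Φ.h₂ p.1 p.2)

/-- A homomorphism into the linear isometries gives a continuous action iff it is continuous for
the strong operator topology (that is, all orbit maps are continuous). -/
theorem continuous_action_iff {V : Type v} [NormedAddCommGroup V] [NormedSpace ℝ V]
    [TopologicalSpace G] (h : G →* (V ≃ₗᵢ[ℝ] V)) :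
    (Continuous fun p : G × V => h p.1 p.2) ↔
      @Continuous G (V ≃ₗᵢ[ℝ] V) _ (TopologicalSpace.induced (fun T x => T x) inferInstance) h := by
  rw [continuous_induced_rng, continuous_pi_iff]
  constructor
  · intro hc x
    exact hc.comp (Continuous.prodMk_left x)
  · intro hc
    exact continuous_prod_of_continuous_lipschitzWith' (fun p : G × V => h p.1 p.2) 1
      (fun g => (h g).lipschitz) hc

/-- A system of birepresentations of a topological group `G` is t-exact if `G` is a Hausdorff
topological group, all birepresentations of the system are continuous, and they do not all remain
continuous for any strictly coarser, not necessarily Hausdorff, group topology on `G`.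
(In Mathlib's order on topologies, `τ < τ'` says that `τ'` is strictly coarser than `τ`.) -/
def IsTExactSystem [τ : TopologicalSpace G] {I : Type w} (Φ : I → Birepresentation.{u, v} G) :
    Prop :=
  IsTopologicalGroup G ∧ T2Space G ∧ (∀ i, (Φ i).ContinuousFor τ) ∧
    ∀ τ' : TopologicalSpace G, @IsTopologicalGroup G τ' _ → τ < τ' →
      ∃ i, ¬ (Φ i).ContinuousFor τ'

/-- A single birepresentation is t-exact if the system consisting of it alone is. -/
def IsTExact [TopologicalSpace G] (Ψ : Birepresentation.{u, v} G) : Prop :=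
  IsTExactSystem fun _ : Unit => Ψ

end Birepresentation

/-- A topological group `G` is birepresentable (a BR-group) if it has a t-exact system of
birepresentations in strong dualities. -/
def IsBRGroup (G : Type u) [Group G] [TopologicalSpace G] : Prop :=
  ∃ (I : Type u) (Φ : I → Birepresentation.{u, u} G),
    Birepresentation.IsTExactSystem Φ ∧ ∀ i, IsStrongDuality (Φ i).ω

/-!
A form on free vector spaces that satisfies a product bound becomes a strong duality by an
interpolation trick, and every continuous bounded length function on `G` supplies such a form.

Let `G` act on a set `S` and let `k : S × S → [-1, 1]` be a symmetric `G`-invariant kernel. It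
pairs points `s` of `S` with finitely supported vectors `y` on `S`, by `⟨s, y⟩ = ∑ t, y t * k s t`.
Take as test vectors those `y` with `‖y‖₁ * sup_s |⟨s, y⟩| ≤ 1`, map `s` to the bounded function
`y ↦ ⟨s, y⟩` on the test vectors, and let `E` be the closed span of these functions in the supremum
norm. Let `F` be the closed span, in the dual of `E`, of the evaluations at the points of `S` (as
unit vectors), with the evaluation pairing. This is regular, `F` carries a dual norm, and the norm
of `E` is a supremum over evaluations at test vectors, which lie in the unit ball of `F`; so the
pairing is a strong duality (`InvariantKernel.isStrongDuality_form`).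

The product in the definition of the test vectors makes both actions continuous at once. If `k s`
and `k s'` differ by at most `ε` uniformly, then `|⟨s, y⟩ - ⟨s', y⟩|` is at most `ε ‖y‖₁` and at
most `|⟨s, y⟩| + |⟨s', y⟩|`; the product of the two bounds is at most `2 ε` for a test vector, so
the images of `s` and `s'` in `E` are at distance at most `√(2 ε)`. In the same way `δ_s - δ_s'`
divided by `√(2 ε)` is a test vector, so the images in `F` are at distance at most `√(2 ε)`
(`InvariantKernel.norm_vec_sub_le`, `InvariantKernel.norm_covec_sub_le`).

For the kernel, each member `i` of a base of minimal cardinality with `1 ∈ i` is given a continuous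
length function `N i ≤ 1` whose small values force membership in that set
(`exists_groupSeminorm_subset_nhds_one`, a form of the Birkhoff-Kakutani theorem). On a disjoint
union of copies of `G`, put `k (i, a) (j, b) = N i (a⁻¹ b)` for `i = j` and `0` otherwise;
subadditivity of `N i` gives the uniform continuity that is needed. The functions `g ↦ N i g` are
matrix coefficients of the action on `E`, so a group topology that makes this action continuous
contains the topology of `G`. The orbit maps are continuous, so a dense subset of `G` in each copy
gives the density bound.
-/

open Filter Topology Pointwise

/-! ### Length functions on topological groups -/

/-- Bounded continuous length functions separate the identity from the complements of its
neighbourhoods. A sequence of neighbourhoods `V (n + 1) * V (n + 1) ⊆ V n` generates a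
left-invariant uniformity with a countable base, hence a pseudometric `d`, and `N g` is the
supremum of `min 1 (d h (h * g))` over `h`; taking the supremum makes it left-invariant.
Subadditivity and symmetry of `N` make it uniformly continuous for both the left and the right
uniformity. -/
theorem exists_groupSeminorm_subset_nhds_one {G : Type u} [Group G] [TopologicalSpace G]
    [IsTopologicalGroup G] {U : Set G} (hU : U ∈ 𝓝 (1 : G)) :
    ∃ N : GroupSeminorm G, (∀ g, N g ≤ 1) ∧ Tendsto N (𝓝 1) (𝓝 0) ∧
      ∃ ε > 0, ∀ g, N g < ε → g ∈ U := by
  have step : ∀ W : {W : Set G // W ∈ 𝓝 (1 : G)}, ∃ W' : {W : Set G // W ∈ 𝓝 (1 : G)},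
      W'.1⁻¹ = W'.1 ∧ W'.1 * W'.1 ⊆ W.1 := fun ⟨W, hW⟩ => by
    obtain ⟨V, hV, -, hinv, hmul⟩ := exists_closed_nhds_one_inv_eq_mul_subset hW
    exact ⟨⟨V, hV⟩, hinv, hmul⟩
  choose next hinv hmul using step
  let V : ℕ → {W : Set G // W ∈ 𝓝 (1 : G)} := fun n => Nat.rec (next ⟨U, hU⟩) (fun _ W => next W) n
  have one_mem : ∀ n, (1 : G) ∈ (V n).1 := fun n => mem_of_mem_nhds (V n).2
  have V_inv : ∀ n, (V n).1⁻¹ = (V n).1 := fun n => by cases n <;> exact hinv _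
  have V_mul : ∀ n, (V (n + 1)).1 * (V (n + 1)).1 ⊆ (V n).1 := fun n => hmul _
  have V_anti : Antitone fun n => (V n).1 := antitone_nat_of_succ_le fun n x hx =>
    V_mul n (Set.mem_mul.2 ⟨x, hx, 1, one_mem (n + 1), mul_one x⟩)
  -- `V 0` was chosen with `V 0 * V 0 ⊆ U`.
  have V_zero : (V 0).1 ⊆ U := fun x hx =>
    hmul ⟨U, hU⟩ (Set.mem_mul.2 ⟨x, hx, 1, one_mem 0, mul_one x⟩)
  let W : ℕ → Set (G × G) := fun n => {p | p.1⁻¹ * p.2 ∈ (V n).1}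
  have W_anti : Antitone W := fun m n h p hp => V_anti h hp
  let B : FilterBasis (G × G) :=
    { sets := Set.range W
      nonempty := Set.range_nonempty _
      inter_sets := by
        rintro _ _ ⟨m, rfl⟩ ⟨n, rfl⟩
        exact ⟨W (max m n), ⟨_, rfl⟩, Set.subset_inter (W_anti (le_max_left _ _))
          (W_anti (le_max_right _ _))⟩ }
  let unif : UniformSpace G := UniformSpace.ofCore <| UniformSpace.Core.mkOfBasis B
    (by rintro _ ⟨n, rfl⟩ x; simpa [W] using one_mem n)
    (by
      rintro _ ⟨n, rfl⟩
      refine ⟨W n, ⟨n, rfl⟩, fun p hp => ?_⟩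
      have : (p.1⁻¹ * p.2)⁻¹ ∈ (V n).1 := by
        rw [← Set.mem_inv, V_inv]; exact hp
      simpa [W, mul_inv_rev] using this)
    (by
      rintro _ ⟨n, rfl⟩
      refine ⟨W (n + 1), ⟨n + 1, rfl⟩, ?_⟩
      rintro ⟨x, z⟩ ⟨y, hxy, hyz⟩
      have := V_mul n (Set.mul_mem_mul hxy hyz)
      simpa [W, mul_assoc] using this)
  have basis : (uniformity G).HasBasis (fun _ : ℕ => True) W := by
    refine ⟨fun t => ?_⟩
    refine (FilterBasis.mem_filter_iff B).trans ?_
    constructor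
    · rintro ⟨_, ⟨n, rfl⟩, h⟩
      exact ⟨n, trivial, h⟩
    · rintro ⟨n, -, h⟩
      exact ⟨_, ⟨n, rfl⟩, h⟩
  have : (uniformity G).IsCountablyGenerated := basis.isCountablyGenerated
  obtain ⟨I, hI⟩ := UniformSpace.metrizable_uniformity G
  have hdist : ∀ s, s ∈ uniformity G ↔ ∃ ε > 0, ∀ a b, I.dist a b < ε → (a, b) ∈ s := by
    intro s
    rw [← hI, @Metric.mem_uniformity_dist G I]
  have bdd : ∀ g, BddAbove (Set.range fun h => min 1 (I.dist h (h * g))) := fun g =>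
    ⟨1, by rintro _ ⟨h, rfl⟩; exact min_le_left _ _⟩
  have nonneg : ∀ a b, 0 ≤ I.dist a b := fun a b => @dist_nonneg G I a b
  have le_sup : ∀ h g, min 1 (I.dist h (h * g)) ≤ ⨆ h, min 1 (I.dist h (h * g)) :=
    fun h g => le_ciSup (bdd g) h
  let N : GroupSeminorm G :=
    { toFun := fun g => ⨆ h, min 1 (I.dist h (h * g))
      map_one' := by simp
      mul_le' := fun a b => by
        refine ciSup_le fun h => ?_
        have h1 := le_sup h a
        have h2 := le_sup (h * a) b
        have h3 := I.dist_triangle h (h * a) (h * (a * b))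
        rw [← mul_assoc] at h3 ⊢
        have h4 := nonneg h (h * a)
        have h5 := nonneg (h * a) (h * a * b)
        rcases min_cases 1 (I.dist h (h * a)) with ⟨e1, _⟩ | ⟨e1, _⟩ <;>
        rcases min_cases 1 (I.dist (h * a) (h * a * b)) with ⟨e2, _⟩ | ⟨e2, _⟩ <;>
        rcases min_cases 1 (I.dist h (h * a * b)) with ⟨e3, _⟩ | ⟨e3, _⟩ <;> linarith
      inv' := by
        have key : ∀ a, (⨆ h, min 1 (I.dist h (h * a⁻¹))) ≤ ⨆ h, min 1 (I.dist h (h * a)) := by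
          intro a
          refine ciSup_le fun h => ?_
          have := le_sup (h * a⁻¹) a
          rwa [inv_mul_cancel_right, I.dist_comm] at this
        intro a
        refine le_antisymm (key a) ?_
        simpa using key a⁻¹ }
  refine ⟨N, fun g => ciSup_le fun h => min_le_left _ _, ?_, ?_⟩
  · rw [Metric.tendsto_nhds]
    intro ε hε
    obtain ⟨n, -, hn⟩ := basis.mem_iff.1
      ((hdist {p | I.dist p.1 p.2 < ε / 2}).2 ⟨ε / 2, half_pos hε, fun a b h => h⟩)
    filter_upwards [(V n).2] with g hg
    rw [Real.dist_0_eq_abs, abs_of_nonneg (apply_nonneg N g)]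
    refine lt_of_le_of_lt (ciSup_le fun h => ?_) (half_lt_self hε)
    have : (h, h * g) ∈ W n := by simpa [W] using hg
    exact (min_le_right _ _).trans (hn this).le
  · obtain ⟨ε, hε, h⟩ := (hdist (W 0)).1 (basis.mem_of_mem (i := 0) trivial)
    refine ⟨min 1 ε, lt_min one_pos hε, fun g hg => ?_⟩
    have h1 : min 1 (I.dist 1 g) < min 1 ε := 
      lt_of_le_of_lt (by have := le_sup 1 g; rwa [one_mul] at this) hg
    have h2 : I.dist 1 g < ε := by
      by_contra! h3
      exact absurd (min_le_min_left 1 h3) (not_le.2 h1)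
    apply V_zero
    simpa [W] using h 1 g h2

/-! ### Closed spans, density and weight -/

/-- The closed linear span of a set of vectors. -/
abbrev closedSpan {V : Type v} [NormedAddCommGroup V] [NormedSpace ℝ V] (A : Set V) :
    Submodule ℝ V :=
  (Submodule.span ℝ A).topologicalClosure

section ClosedSpan

variable {V : Type u} [NormedAddCommGroup V] [NormedSpace ℝ V]

theorem subset_closedSpan (A : Set V) : A ⊆ closedSpan A :=
  Submodule.subset_span.trans (Submodule.le_topologicalClosure _)

theorem dense_span_range_closedSpan {S : Type v} (p : S → V) :
    Dense (Submodule.span ℝ (Set.range fun s =>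
      (⟨p s, subset_closedSpan _ ⟨s, rfl⟩⟩ : closedSpan (Set.range p))) :
      Set (closedSpan (Set.range p))) := by
  intro x
  rw [closure_subtype, ← Submodule.coe_subtype, ← Submodule.map_coe, Submodule.map_span,
    ← Set.range_comp]
  exact x.2

theorem topDensity_le_of_dense {X : Type u} [TopologicalSpace X] {κ : Cardinal.{u}} (hκ : ℵ₀ ≤ κ)
    {D : Set X} (hD : Dense D) (hcard : #D ≤ κ) : topDensity X ≤ κ := by
  refine max_le hκ (le_trans (csInf_le' ?_) hcard)
  exact ⟨D, hD, rfl⟩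

/-- If `D` accumulates at every vector of a set with dense linear span, the rational linear
combinations of `D` are dense, and there are at most `max #D ℵ₀` of them. -/
theorem topDensity_le_of_dense_span {κ : Cardinal.{u}} (hκ : ℵ₀ ≤ κ) {A D : Set V}
    (hA : Dense (Submodule.span ℝ A : Set V)) (hAD : A ⊆ closure D) (hcard : #D ≤ κ) :
    topDensity V ≤ κ := by
  let _ : Module ℚ V := Module.compHom V (algebraMap ℚ ℝ)
  let Q : Submodule ℚ V := Submodule.span ℚ D
  have hQcard : #Q ≤ κ := by
    have hsurj : Q = LinearMap.range (Finsupp.linearCombination ℚ ((↑) : D → V)) := by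
      rw [Finsupp.range_linearCombination, Subtype.range_coe]
    rw [hsurj]
    refine (Cardinal.mk_range_le (f := Finsupp.linearCombination ℚ ((↑) : D → V))).trans ?_
    rcases isEmpty_or_nonempty D with h | h
    · exact (Cardinal.le_one_iff_subsingleton.2 inferInstance).trans (one_le_aleph0.trans hκ)
    · rw [Cardinal.mk_finsupp_lift_of_infinite']
      simpa using ⟨hcard, hκ⟩
  have hreal : ∀ x ∈ closure (Q : Set V), ∀ c : ℝ, c • x ∈ closure (Q : Set V) := by
    intro x hx c
    have hrat : ∀ q : ℚ, (q : ℝ) • x ∈ closure (Q : Set V) := fun q =>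
      map_mem_closure (continuous_const_smul (q : ℝ)) hx fun y hy => by
        rw [Rat.cast_smul_eq_qsmul]; exact Q.smul_mem q hy
    have hcl : IsClosed {c : ℝ | c • x ∈ closure (Q : Set V)} :=
      isClosed_closure.preimage (continuous_id.smul continuous_const)
    have : closure (Set.range ((↑) : ℚ → ℝ)) ⊆ {c : ℝ | c • x ∈ closure (Q : Set V)} :=
      closure_minimal (by rintro _ ⟨q, rfl⟩; exact hrat q) hcl
    exact this (by rw [Rat.denseRange_cast.closure_range]; trivial)
  -- The closure of the rational span is a real subspace.
  let R : Submodule ℝ V :=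
    { Q.toAddSubgroup.topologicalClosure with
      carrier := closure (Q : Set V)
      smul_mem' := fun c x hx => hreal x hx c }
  have hspan : (Submodule.span ℝ A : Set V) ⊆ closure Q := by
    have : Submodule.span ℝ A ≤ R := Submodule.span_le.2
      (hAD.trans (closure_mono Submodule.subset_span))
    exact this
  refine topDensity_le_of_dense hκ (D := Q) (fun x => ?_) hQcard
  exact closure_minimal hspan isClosed_closure (hA x)

theorem exists_basis_card_le_topWeight (X : Type u) [TopologicalSpace X] :
    ∃ B : Set (Set X), TopologicalSpace.IsTopologicalBasis B ∧ #B ≤ topWeight X := by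
  obtain ⟨B, hB, h⟩ := csInf_mem (s := {κ | ∃ B : Set (Set X),
    TopologicalSpace.IsTopologicalBasis B ∧ #B = κ})
    ⟨_, _, TopologicalSpace.isTopologicalBasis_opens, rfl⟩
  exact ⟨B, hB, h.le.trans (le_max_right _ _)⟩

theorem exists_dense_card_le_topWeight (X : Type u) [TopologicalSpace X] :
    ∃ D : Set X, Dense D ∧ #D ≤ topWeight X := by
  obtain ⟨B, hB, hcard⟩ := exists_basis_card_le_topWeight X
  rcases isEmpty_or_nonempty X with h | h
  · exact ⟨∅, fun x => h.elim x, by simp⟩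
  choose! p hp using fun (U : Set X) (hU : U.Nonempty) => hU
  refine ⟨p '' B, hB.dense_iff.2 fun U hU hne => ⟨p U, hp U hne, U, hU, rfl⟩,
    mk_image_le.trans hcard⟩

end ClosedSpan

/-! ### Isometric representations -/

section Representation

variable {G : Type u} [Group G] {V : Type v} [NormedAddCommGroup V] [NormedSpace ℝ V]

/-- A multiplicative family of linear isometries that sends `1` to the identity consists of
surjective isometries, and is thus a homomorphism into the group of these. -/
def isometricRep (T : G → V →ₗᵢ[ℝ] V) (map_one : ∀ v, T 1 v = v)
    (map_mul : ∀ a b v, T (a * b) v = T a (T b v)) : G →* (V ≃ₗᵢ[ℝ] V) where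
  toFun g :=
    { toFun := T g
      invFun := T g⁻¹
      map_add' := map_add (T g)
      map_smul' := map_smul (T g)
      left_inv := fun v => by rw [← map_mul, inv_mul_cancel, map_one]
      right_inv := fun v => by rw [← map_mul, mul_inv_cancel, map_one]
      norm_map' := (T g).norm_map }
  map_one' := LinearIsometryEquiv.ext map_one
  map_mul' a b := LinearIsometryEquiv.ext (map_mul a b)

theorem map_mem_closedSpan {A : Set V} (h : G →* (V ≃ₗᵢ[ℝ] V)) (hA : ∀ g, ∀ a ∈ A, h g a ∈ A)
    (g : G) {v : V} (hv : v ∈ closedSpan A) : h g v ∈ closedSpan A := by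
  refine map_mem_closure (h g).continuous hv fun x hx => ?_
  have : Submodule.span ℝ A ≤ (Submodule.span ℝ A).comap (h g).toLinearEquiv.toLinearMap :=
    Submodule.span_le.2 fun a ha => Submodule.subset_span (hA g a ha)
  exact this hx

/-- The restriction of an isometric representation to the closed span of an invariant set. -/
noncomputable def closedSpanRep {A : Set V} (h : G →* (V ≃ₗᵢ[ℝ] V)) (hA : ∀ g, ∀ a ∈ A, h g a ∈ A) :
    G →* (closedSpan A ≃ₗᵢ[ℝ] closedSpan A) :=
  isometricRep
    (fun g =>
      { toLinearMap := (h g).toLinearEquiv.toLinearMap.restrict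
          fun _ hv => map_mem_closedSpan h hA g hv
        norm_map' := fun v => (h g).norm_map v })
    (fun v => Subtype.ext (by
      change h 1 (v : V) = v
      rw [map_one]; rfl))
    (fun a b v => Subtype.ext (by
      change h (a * b) (v : V) = h a (h b v)
      rw [map_mul]; rfl))

/-- The dual representation, `(g φ) v = φ (g⁻¹ v)`. -/
noncomputable def contragredient (h : G →* (V ≃ₗᵢ[ℝ] V)) :
    G →* (StrongDual ℝ V ≃ₗᵢ[ℝ] StrongDual ℝ V) :=
  isometricRep
    (fun g =>
      { toFun := fun φ => φ.comp ((h g⁻¹ : V ≃ₗᵢ[ℝ] V) : V →L[ℝ] V)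
        map_add' := fun φ ψ => rfl
        map_smul' := fun c φ => rfl
        norm_map' := fun φ => φ.opNorm_comp_linearIsometryEquiv (h g⁻¹) })
    (fun φ => by
      ext v
      change φ (h 1⁻¹ v) = φ v
      rw [inv_one, map_one]; rfl)
    (fun a b φ => by
      ext v
      change φ (h (a * b)⁻¹ v) = φ (h b⁻¹ (h a⁻¹ v))
      rw [mul_inv_rev, map_mul]; rfl)

@[simp]
theorem contragredient_apply (h : G →* (V ≃ₗᵢ[ℝ] V)) (g : G) (φ : StrongDual ℝ V) (v : V) :
    contragredient h g φ v = φ (h g⁻¹ v) := rfl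

/-- The representation on the bounded functions on a `G`-set by translation of the argument,
`(g x) y = x (g⁻¹ y)`. -/
noncomputable def lpPermRep (Y : Type w) [MulAction G Y] :
    G →* (lp (fun _ : Y => ℝ) ⊤ ≃ₗᵢ[ℝ] lp (fun _ : Y => ℝ) ⊤) :=
  isometricRep
    (fun g =>
      { toFun := fun x => ⟨fun y => x (g⁻¹ • y), memℓp_infty (by
          obtain ⟨C, hC⟩ := memℓp_infty_iff.1 x.2
          exact ⟨C, by rintro _ ⟨y, rfl⟩; exact hC ⟨g⁻¹ • y, rfl⟩⟩)⟩
        map_add' := fun x z => rfl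
        map_smul' := fun c x => rfl
        norm_map' := fun x => by
          rw [lp.norm_eq_ciSup, lp.norm_eq_ciSup]
          exact Equiv.iSup_congr (MulAction.toPerm g⁻¹) fun y => rfl })
    (fun x => lp.ext (funext fun y => congrArg x (by simp)))
    (fun a b x => lp.ext (funext fun y => congrArg x (by simp [mul_smul])))

/-- An isometric action is continuous as soon as the orbit maps of a set with dense span are
continuous at `1`. -/
theorem continuous_rep_of_dense_span [TopologicalSpace G] [IsTopologicalGroup G]
    (h : G →* (V ≃ₗᵢ[ℝ] V)) {A : Set V} (hA : Dense (Submodule.span ℝ A : Set V))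
    (hc : ∀ a ∈ A, Tendsto (fun g => h g a) (𝓝 1) (𝓝 a)) :
    Continuous fun p : G × V => h p.1 p.2 := by
  have h_one : ∀ v, h 1 v = v := fun v => by rw [map_one]; rfl
  have h_mul : ∀ a b v, h (a * b) v = h a (h b v) := fun a b v => by rw [map_mul]; rfl
  have hspan : ∀ v ∈ Submodule.span ℝ A, Tendsto (fun g => h g v) (𝓝 1) (𝓝 v) := by
    intro v hv
    induction hv using Submodule.span_induction with
    | mem a ha => exact hc a ha
    | zero => simp
    | add x y _ _ hx hy => simpa using hx.add hy
    | smul c x _ hx => simpa using hx.const_smul c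
  have hall : ∀ v, Tendsto (fun g => h g v) (𝓝 1) (𝓝 v) := by
    intro v
    rw [Metric.tendsto_nhds]
    intro ε hε
    obtain ⟨w, hw, hvw⟩ := Metric.mem_closure_iff.1 (hA v) (ε / 3) (by positivity)
    filter_upwards [Metric.tendsto_nhds.1 (hspan w hw) (ε / 3) (by positivity)] with g hg
    have h1 : dist (h g v) (h g w) = dist v w := (h g).dist_map v w
    have h2 := dist_triangle4 (h g v) (h g w) w v
    rw [dist_comm w v] at h2
    linarith
  refine continuous_prod_of_continuous_lipschitzWith' (fun p : G × V => h p.1 p.2) 1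
    (fun g => (h g).lipschitz) fun v => continuous_iff_continuousAt.2 fun a => ?_
  have hshift : Tendsto (fun g => a⁻¹ * g) (𝓝 a) (𝓝 1) := by
    have : Continuous fun g : G => a⁻¹ * g := by fun_prop
    simpa using this.tendsto a
  have := ((h a).continuous.tendsto v).comp ((hall v).comp hshift)
  refine this.congr fun g => ?_
  simp

end Representation

/-! ### Invariant kernels and their test vectors -/

/-- A symmetric kernel on a `G`-set, invariant under the diagonal action, with values in
`[-1, 1]`. -/
structure InvariantKernel (G : Type u) [Group G] (S : Type v) [MulAction G S] where
  toFun : S → S → ℝ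
  symm : ∀ s t, toFun s t = toFun t s
  abs_le_one : ∀ s t, |toFun s t| ≤ 1
  smul_smul : ∀ (g : G) s t, toFun (g • s) (g • t) = toFun s t

namespace InvariantKernel

variable {G : Type u} [Group G] {S : Type v} [MulAction G S] (K : InvariantKernel G S)

/-- The `ℓ¹` norm of a finitely supported vector. -/
def mass (y : S →₀ ℝ) : ℝ := y.sum fun _ c => |c|

theorem mass_nonneg (y : S →₀ ℝ) : 0 ≤ mass y := Finset.sum_nonneg fun _ _ => abs_nonneg _

theorem mass_single (t : S) (c : ℝ) : mass (Finsupp.single t c) = |c| :=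
  Finsupp.sum_single_index (abs_zero)

theorem mass_smul (c : ℝ) (y : S →₀ ℝ) : mass (c • y) = |c| * mass y := by
  unfold mass
  rw [Finsupp.sum_smul_index fun _ => abs_zero]
  simp only [abs_mul]
  exact Finset.mul_sum _ _ _ |>.symm

theorem mass_sub_le (y z : S →₀ ℝ) : mass (y - z) ≤ mass y + mass z := by
  classical
  have key : ∀ x : S →₀ ℝ, x.support ⊆ y.support ∪ z.support →
      mass x = ∑ t ∈ y.support ∪ z.support, |x t| := fun x hx =>
    Finsupp.sum_of_support_subset x hx _ fun _ _ => abs_zero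
  rw [key _ Finsupp.support_sub, key y Finset.subset_union_left, key z Finset.subset_union_right,
    ← Finset.sum_add_distrib]
  exact Finset.sum_le_sum fun t _ => abs_sub (y t) (z t)

theorem abs_linearCombination_le {u : S → ℝ} {C : ℝ} (hu : ∀ t, |u t| ≤ C) (y : S →₀ ℝ) :
    |Finsupp.linearCombination ℝ u y| ≤ C * mass y := by
  rw [Finsupp.linearCombination_apply, Finsupp.sum, mass, Finsupp.sum, Finset.mul_sum]
  refine (Finset.abs_sum_le_sum_abs _ _).trans (Finset.sum_le_sum fun t _ => ?_)
  rw [smul_eq_mul, abs_mul, mul_comm]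
  exact mul_le_mul_of_nonneg_right (hu t) (abs_nonneg _)

/-- The pairing `∑ t, y t * K s t` of a point with a finitely supported vector. -/
noncomputable def pair (s : S) : (S →₀ ℝ) →ₗ[ℝ] ℝ := Finsupp.linearCombination ℝ (K.toFun s)

@[simp]
theorem pair_single (s t : S) (c : ℝ) : K.pair s (Finsupp.single t c) = c * K.toFun s t := by
  simp [pair]

/-- The test vectors: those `y` for which the `ℓ¹` norm of `y` times the supremum of `|K.pair s y|`
over `s` is at most `1`. The set need not be convex; only suprema over it are used. -/
def testSet : Set (S →₀ ℝ) := {y | ∀ s, mass y * |K.pair s y| ≤ 1}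

/-- Since `|K.pair s y| ≤ mass y`, the square of the pairing is at most
`mass y * |K.pair s y| ≤ 1`. -/
theorem abs_pair_le_one {y : S →₀ ℝ} (hy : y ∈ K.testSet) (s : S) : |K.pair s y| ≤ 1 := by
  have h1 := abs_linearCombination_le (K.abs_le_one s) y
  have h2 := hy s
  change |K.pair s y| ≤ _ at h1
  nlinarith [abs_nonneg (K.pair s y)]

theorem single_mem_testSet (t : S) : Finsupp.single t 1 ∈ K.testSet := fun s => by
  simpa [mass_single] using K.abs_le_one s t

theorem smul_toFun_inv (g : G) (s t : S) : K.toFun (g⁻¹ • s) t = K.toFun s (g • t) := by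
  rw [← K.smul_smul g, smul_inv_smul]

/-- The action on test vectors by moving the points of the support. -/
noncomputable instance : MulAction G K.testSet where
  smul g y := ⟨Finsupp.equivMapDomain (MulAction.toPerm g) y, fun s => by
    have h1 : mass (Finsupp.equivMapDomain (MulAction.toPerm g) (y : S →₀ ℝ)) = mass y.1 :=
      Finsupp.sum_equivMapDomain _ _ _
    have h2 : K.pair s (Finsupp.equivMapDomain (MulAction.toPerm g) y) = K.pair (g⁻¹ • s) y := by
      rw [pair, Finsupp.linearCombination_equivMapDomain, pair]
      congr 2
      funext t
      exact (K.smul_toFun_inv g s t).symm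
    rw [h1, h2]
    exact y.2 _⟩
  one_smul y := Subtype.ext (Finsupp.ext fun t => by
    change y.1 ((MulAction.toPerm (1 : G)).symm t) = y.1 t
    simp)
  mul_smul a b y := Subtype.ext (Finsupp.ext fun t => by
    change y.1 ((MulAction.toPerm (a * b)).symm t) =
      y.1 ((MulAction.toPerm b).symm ((MulAction.toPerm a).symm t))
    simp [SemigroupAction.mul_smul])

theorem pair_inv_smul (g : G) (s : S) (y : K.testSet) :
    K.pair s ((g⁻¹ • y : K.testSet) : S →₀ ℝ) = K.pair (g • s) (y : S →₀ ℝ) := by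
  change K.pair s (Finsupp.equivMapDomain (MulAction.toPerm g⁻¹) y.1) = _
  rw [pair, Finsupp.linearCombination_equivMapDomain, pair]
  congr 2
  funext t
  exact K.smul_smul g s (g⁻¹ • t) |>.symm.trans (by simp)

/-! ### The left space -/

/-- The image of a point in the bounded functions on the test vectors, `y ↦ K.pair s y`. -/
noncomputable def vec (s : S) : lp (fun _ : K.testSet => ℝ) ⊤ :=
  ⟨fun y => K.pair s y, memℓp_infty ⟨1, by
    rintro _ ⟨y, rfl⟩
    exact K.abs_pair_le_one y.2 s⟩⟩

theorem lpPermRep_vec (g : G) (s : S) : lpPermRep K.testSet g (K.vec s) = K.vec (g • s) :=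
  lp.ext (funext fun y => K.pair_inv_smul g s y)

/-- On a test vector the square of the difference is bounded by the product of the estimate
`ε * mass y`, from uniform closeness of the kernels, with `|K.pair s y| + |K.pair s' y|`. -/
theorem norm_vec_sub_le {s s' : S} {ε : ℝ} (h : ∀ t, |K.toFun s t - K.toFun s' t| ≤ ε) :
    ‖K.vec s - K.vec s'‖ ≤ √(2 * ε) := by
  refine lp.norm_le_of_forall_le (Real.sqrt_nonneg _) fun y => Real.abs_le_sqrt ?_
  change (K.pair s y - K.pair s' y) ^ 2 ≤ 2 * ε
  have hε : 0 ≤ ε := (abs_nonneg _).trans (h s)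
  have h1 : |K.pair s y - K.pair s' y| ≤ ε * mass y.1 := by
    have h2 : K.pair s y - K.pair s' y =
        Finsupp.linearCombination ℝ (fun t => K.toFun s t - K.toFun s' t) y.1 := by
      simp [pair, Finsupp.linearCombination_apply, mul_sub, Finsupp.sum]
    rw [h2]
    exact abs_linearCombination_le h _
  have h3 := abs_sub (K.pair s y) (K.pair s' y)
  have h4 := y.2 s
  have h5 := y.2 s'
  have h6 := mass_nonneg y.1
  calc (K.pair s y - K.pair s' y) ^ 2
      = |K.pair s y - K.pair s' y| * |K.pair s y - K.pair s' y| := by rw [abs_mul_abs_self, sq]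
    _ ≤ (ε * mass y.1) * (|K.pair s y| + |K.pair s' y|) := by gcongr
    _ = ε * (mass y.1 * |K.pair s y| + mass y.1 * |K.pair s' y|) := by ring
    _ ≤ ε * (1 + 1) := by gcongr
    _ = 2 * ε := by ring

/-- The Banach space spanned by the points, as bounded functions on the test vectors. It is a
definition rather than an abbreviation so that instance search does not unfold it. -/
def LeftSpace : Type v := closedSpan (Set.range K.vec)

noncomputable instance : NormedAddCommGroup K.LeftSpace :=
  inferInstanceAs (NormedAddCommGroup (closedSpan (Set.range K.vec)))

noncomputable instance : NormedSpace ℝ K.LeftSpace :=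
  inferInstanceAs (NormedSpace ℝ (closedSpan (Set.range K.vec)))

instance : CompleteSpace K.LeftSpace :=
  (Submodule.isClosed_topologicalClosure (Submodule.span ℝ (Set.range K.vec))).completeSpace_coe

/-- The image of a point in the left space. -/
noncomputable def leftVec (s : S) : K.LeftSpace := ⟨K.vec s, subset_closedSpan _ ⟨s, rfl⟩⟩

theorem dense_span_leftVec :
    Dense (Submodule.span ℝ (Set.range K.leftVec) : Set K.LeftSpace) :=
  dense_span_range_closedSpan K.vec

/-- The action on the left space; it permutes the images of the points. -/
noncomputable def leftRep : G →* (K.LeftSpace ≃ₗᵢ[ℝ] K.LeftSpace) :=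
  closedSpanRep (lpPermRep K.testSet) (by
    rintro g _ ⟨s, rfl⟩
    exact ⟨g • s, (K.lpPermRep_vec g s).symm⟩)

theorem leftRep_leftVec (g : G) (s : S) : K.leftRep g (K.leftVec s) = K.leftVec (g • s) :=
  Subtype.ext (K.lpPermRep_vec g s)

/-! ### The right space -/

/-- Evaluation at a test vector, as a functional on the left space. -/
noncomputable def coord (y : K.testSet) : StrongDual ℝ K.LeftSpace :=
  LinearMap.mkContinuous
    { toFun := fun x => x.1 y
      map_add' := fun _ _ => rfl
      map_smul' := fun _ _ => rfl } 1
    fun x => by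
      rw [one_mul]
      exact lp.norm_apply_le_norm (by simp) x.1 y

theorem norm_coord_le (y : K.testSet) : ‖K.coord y‖ ≤ 1 :=
  LinearMap.mkContinuous_norm_le _ zero_le_one _

/-- Evaluation at the unit vector of a point, which is a test vector as the kernel is bounded by
`1`. -/
noncomputable def covec (t : S) : StrongDual ℝ K.LeftSpace :=
  K.coord ⟨Finsupp.single t 1, K.single_mem_testSet t⟩

@[simp]
theorem covec_leftVec (s t : S) : K.covec t (K.leftVec s) = K.toFun s t := by
  change K.pair s (Finsupp.single t 1) = _
  simp

/-- Evaluation is linear in the test vector, although the elements of the left space are arbitrary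
limits of functions on the test vectors: both sides agree on the images of points, whose span is
dense. -/
theorem coord_eq_linearCombination (y : K.testSet) :
    K.coord y = Finsupp.linearCombination ℝ K.covec (y : S →₀ ℝ) := by
  refine ContinuousLinearMap.ext_on K.dense_span_leftVec ?_
  rintro _ ⟨s, rfl⟩
  change K.pair s y.1 = _
  rw [pair, Finsupp.linearCombination_apply, Finsupp.linearCombination_apply, Finsupp.sum,
    Finsupp.sum, sum_apply]
  simp

/-- The difference of the two unit vectors, divided by `√(2 * ε)`, is a test vector. -/
theorem norm_covec_sub_le {t t' : S} {ε : ℝ} (hε : 0 < ε)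
    (h : ∀ s, |K.toFun t s - K.toFun t' s| ≤ ε) : ‖K.covec t - K.covec t'‖ ≤ √(2 * ε) := by
  set r := √(2 * ε)
  have hr : 0 < r := Real.sqrt_pos.2 (by positivity)
  have hr2 : r * r = 2 * ε := Real.mul_self_sqrt (by positivity)
  have hy : r⁻¹ • (Finsupp.single t 1 - Finsupp.single t' 1) ∈ K.testSet := fun s => by
    have h1 : mass (Finsupp.single t (1 : ℝ) - Finsupp.single t' 1) ≤ 2 :=
      (mass_sub_le _ _).trans (by rw [mass_single, mass_single]; norm_num)
    have h2 : |K.pair s (Finsupp.single t 1 - Finsupp.single t' 1)| ≤ ε := by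
      rw [map_sub, pair_single, pair_single, one_mul, one_mul, K.symm s, K.symm s]
      exact h s
    rw [mass_smul, map_smul, smul_eq_mul, abs_mul, abs_of_pos (inv_pos.2 hr)]
    calc r⁻¹ * mass (Finsupp.single t (1 : ℝ) - Finsupp.single t' 1) *
          (r⁻¹ * |K.pair s (Finsupp.single t 1 - Finsupp.single t' 1)|)
        ≤ r⁻¹ * 2 * (r⁻¹ * ε) := by gcongr
      _ = 2 * ε / (r * r) := by field_simp
      _ = 1 := by rw [hr2]; exact div_self (by positivity)
  have h1 : K.coord ⟨_, hy⟩ = r⁻¹ • (K.covec t - K.covec t') := by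
    rw [coord_eq_linearCombination]
    simp
  have h2 := K.norm_coord_le ⟨_, hy⟩
  rw [h1, norm_smul, norm_inv, Real.norm_of_nonneg hr.le, inv_mul_le_iff₀ hr, mul_one] at h2
  exact h2

theorem contragredient_covec (g : G) (t : S) :
    contragredient K.leftRep g (K.covec t) = K.covec (g • t) := by
  refine ContinuousLinearMap.ext_on K.dense_span_leftVec ?_
  rintro _ ⟨s, rfl⟩
  rw [contragredient_apply, leftRep_leftVec, covec_leftVec, covec_leftVec, smul_toFun_inv]

/-- The Banach space spanned, in the dual of the left space, by the evaluations at points. -/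
def RightSpace : Type v := closedSpan (Set.range K.covec)

noncomputable instance : NormedAddCommGroup K.RightSpace :=
  inferInstanceAs (NormedAddCommGroup (closedSpan (Set.range K.covec)))

noncomputable instance : NormedSpace ℝ K.RightSpace :=
  inferInstanceAs (NormedSpace ℝ (closedSpan (Set.range K.covec)))

instance : CompleteSpace K.RightSpace :=
  (Submodule.isClosed_topologicalClosure (Submodule.span ℝ (Set.range K.covec))).completeSpace_coe

/-- The image of a point in the right space. -/
noncomputable def rightVec (t : S) : K.RightSpace := ⟨K.covec t, subset_closedSpan _ ⟨t, rfl⟩⟩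

theorem dense_span_rightVec :
    Dense (Submodule.span ℝ (Set.range K.rightVec) : Set K.RightSpace) :=
  dense_span_range_closedSpan K.covec

/-- The restriction of the dual representation to the right space. -/
noncomputable def rightRep : G →* (K.RightSpace ≃ₗᵢ[ℝ] K.RightSpace) :=
  closedSpanRep (contragredient K.leftRep) (by
    rintro g _ ⟨t, rfl⟩
    exact ⟨g • t, (K.contragredient_covec g t).symm⟩)

theorem rightRep_rightVec (g : G) (t : S) : K.rightRep g (K.rightVec t) = K.rightVec (g • t) :=
  Subtype.ext (K.contragredient_covec g t)

theorem coord_mem_rightSpace (y : K.testSet) : K.coord y ∈ closedSpan (Set.range K.covec) := by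
  rw [coord_eq_linearCombination]
  refine Submodule.le_topologicalClosure _ ?_
  rw [← Finsupp.range_linearCombination]
  exact ⟨_, rfl⟩

/-! ### The duality -/

/-- The evaluation pairing between the left and the right space. -/
noncomputable def form : K.LeftSpace →ₗ[ℝ] K.RightSpace →ₗ[ℝ] ℝ :=
  LinearMap.mk₂ ℝ (fun x φ => φ.1 x)
    (fun x z φ => map_add φ.1 x z)
    (fun c x φ => map_smul φ.1 c x)
    (fun _ _ _ => rfl) (fun _ _ _ => rfl)

theorem isRegularForm_form : IsRegularForm K.form := fun x φ => by
  rw [mul_comm]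
  exact φ.1.le_opNorm x

/-- The norm of the left space is a supremum over evaluations at test vectors, which belong to the
unit ball of the right space; the norm of the right space is a dual norm by definition. -/
theorem isStrongDuality_form : IsStrongDuality K.form := by
  constructor
  · intro x hx hb
    obtain ⟨C, hC⟩ := isBounded_iff_forall_norm_le.1 hb
    refine hx (isBounded_iff_forall_norm_le.2 ⟨max C 0, ?_⟩)
    rintro _ ⟨n, rfl⟩
    refine lp.norm_le_of_forall_le (le_max_right _ _) fun y => (hC _ ?_).trans (le_max_left _ _)
    exact ⟨n, ⟨K.coord y, K.coord_mem_rightSpace y⟩, K.norm_coord_le y, rfl⟩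
  · intro f hf hb
    obtain ⟨C, hC⟩ := isBounded_iff_forall_norm_le.1 hb
    refine hf (isBounded_iff_forall_norm_le.2 ⟨max C 0, ?_⟩)
    rintro _ ⟨n, rfl⟩
    refine ContinuousLinearMap.opNorm_le_of_unit_norm (le_max_right _ _) fun x hx =>
      (hC _ ?_).trans (le_max_left _ _)
    exact ⟨n, x, hx.le, rfl⟩

theorem form_rep (g : G) (x : K.LeftSpace) (φ : K.RightSpace) :
    K.form (K.leftRep g x) (K.rightRep g φ) = K.form x φ := by
  change φ.1 (K.leftRep g⁻¹ (K.leftRep g x)) =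
    φ.1 x
  have : K.leftRep g⁻¹ (K.leftRep g x) = (K.leftRep g⁻¹ * K.leftRep g) x := rfl
  rw [this, ← map_mul, inv_mul_cancel, map_one]
  rfl

theorem continuous_form : Continuous fun p : K.LeftSpace × K.RightSpace => K.form p.1 p.2 :=
  (continuous_subtype_val.comp continuous_snd).clm_apply continuous_fst

variable [TopologicalSpace G]

/-! ### Continuity of the actions -/

/-- As `g` tends to `1`, the kernel function of `g • s` tends to that of `s` uniformly. By the
symmetry of the kernel this covers both of its arguments. -/
def IsOrbitContinuous : Prop :=
  ∀ s, ∀ ε > 0, ∀ᶠ g in 𝓝 (1 : G), ∀ t, |K.toFun (g • s) t - K.toFun s t| ≤ ε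

variable {K}

theorem tendsto_orbit_of_norm_sub_le {V : Type*} [NormedAddCommGroup V] {p : S → V}
    (hp : ∀ s s' ε, 0 < ε → (∀ t, |K.toFun s t - K.toFun s' t| ≤ ε) → ‖p s - p s'‖ ≤ √(2 * ε))
    (hK : K.IsOrbitContinuous) (s : S) : Tendsto (fun g : G => p (g • s)) (𝓝 1) (𝓝 (p s)) := by
  rw [Metric.tendsto_nhds]
  intro ε hε
  filter_upwards [hK s (ε ^ 2 / 8) (by positivity)] with g hg
  rw [dist_eq_norm]
  refine (hp _ _ _ (by positivity) hg).trans_lt ?_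
  rw [show 2 * (ε ^ 2 / 8) = (ε / 2) ^ 2 by ring, Real.sqrt_sq (by positivity)]
  exact half_lt_self hε

variable [IsTopologicalGroup G]

theorem IsOrbitContinuous.continuous_leftRep (hK : K.IsOrbitContinuous) :
    Continuous fun p : G × K.LeftSpace => K.leftRep p.1 p.2 := by
  refine continuous_rep_of_dense_span _ K.dense_span_leftVec ?_
  rintro _ ⟨s, rfl⟩
  simp only [leftRep_leftVec]
  exact tendsto_orbit_of_norm_sub_le (p := K.leftVec) (fun s s' ε _ h => K.norm_vec_sub_le h) hK s

theorem IsOrbitContinuous.continuous_rightRep (hK : K.IsOrbitContinuous) :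
    Continuous fun p : G × K.RightSpace => K.rightRep p.1 p.2 := by
  refine continuous_rep_of_dense_span _ K.dense_span_rightVec ?_
  rintro _ ⟨s, rfl⟩
  simp only [rightRep_rightVec]
  exact tendsto_orbit_of_norm_sub_le (p := K.rightVec)
    (fun s s' ε hε h => K.norm_covec_sub_le hε h) hK s

end InvariantKernel

namespace InvariantKernel

variable {G : Type u} [Group G]

/-! ### The birepresentation of an invariant kernel -/

/-- The birepresentation on the left and right spaces of a kernel. -/
noncomputable def birepresentation {S : Type u} [MulAction G S] (K : InvariantKernel G S) :
    Birepresentation.{u, u} G where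
  E := K.LeftSpace
  F := K.RightSpace
  ω := K.form
  continuous_ω := K.continuous_form
  h₁ := K.leftRep
  h₂ := K.rightRep
  invariant := K.form_rep

open Classical in
/-- The kernel of a family of length functions bounded by `1`: on a disjoint union of copies of the
group, it is `N i (a⁻¹ * b)` inside the copy with index `i` and `0` between different copies. The
disjoint union takes the place of a direct sum of birepresentations. -/
noncomputable def ofGroupSeminorms {I : Type v} (N : I → GroupSeminorm G)
    (hN : ∀ i g, N i g ≤ 1) : InvariantKernel G (Σ _ : I, G) where
  toFun s t := if s.1 = t.1 then N s.1 (s.2⁻¹ * t.2) else 0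
  symm := by
    rintro ⟨i, a⟩ ⟨j, b⟩
    by_cases h : i = j
    · subst h
      rw [if_pos rfl, if_pos rfl, ← map_inv_eq_map (N i) (b⁻¹ * a), mul_inv_rev, inv_inv]
    · rw [if_neg h, if_neg (Ne.symm h)]
  abs_le_one := by
    rintro ⟨i, a⟩ ⟨j, b⟩
    dsimp only
    split_ifs
    · rw [abs_of_nonneg (apply_nonneg _ _)]
      exact hN _ _
    · simp
  smul_smul := by
    rintro g ⟨i, a⟩ ⟨j, b⟩
    simp [mul_assoc]

theorem ofGroupSeminorms_mk_same {I : Type v} {N : I → GroupSeminorm G}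
    (hN : ∀ i g, N i g ≤ 1) (i : I) (a b : G) :
    (ofGroupSeminorms N hN).toFun ⟨i, a⟩ ⟨i, b⟩ = N i (a⁻¹ * b) := if_pos rfl

variable [TopologicalSpace G] [IsTopologicalGroup G]

/-- Replacing `a` by `g * a` changes `N i (a⁻¹ * b)` by at most `N i (a⁻¹ * g⁻¹ * a)`, whatever `b`
is. -/
theorem isOrbitContinuous_ofGroupSeminorms {I : Type v} {N : I → GroupSeminorm G}
    (hN : ∀ i g, N i g ≤ 1) (hc : ∀ i, Tendsto (N i) (𝓝 1) (𝓝 0)) :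
    (ofGroupSeminorms N hN).IsOrbitContinuous := by
  rintro ⟨i, a⟩ ε hε
  have hconj : Tendsto (fun g => a⁻¹ * g⁻¹ * a) (𝓝 1) (𝓝 1) := by
    have : Continuous fun g : G => a⁻¹ * g⁻¹ * a := by fun_prop
    simpa using this.tendsto 1
  filter_upwards [((hc i).comp hconj).eventually_le_const hε] with g hg
  rintro ⟨j, b⟩
  by_cases h : i = j
  · subst h
    rw [Sigma.smul_mk, ofGroupSeminorms_mk_same, ofGroupSeminorms_mk_same, smul_eq_mul]
    refine le_trans ?_ hg
    have e : (g * a)⁻¹ * b = (a⁻¹ * g⁻¹ * a) * (a⁻¹ * b) := by group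
    have e' : a⁻¹ * b = (a⁻¹ * g⁻¹ * a)⁻¹ * ((g * a)⁻¹ * b) := by group
    have h1 := map_mul_le_add (N i) (a⁻¹ * g⁻¹ * a) (a⁻¹ * b)
    have h2 := map_mul_le_add (N i) (a⁻¹ * g⁻¹ * a)⁻¹ ((g * a)⁻¹ * b)
    rw [← e] at h1
    rw [← e', map_inv_eq_map] at h2
    exact abs_sub_le_iff.2 ⟨by simp only [Function.comp]; linarith,
      by simp only [Function.comp]; linarith⟩
  · have h1 : (ofGroupSeminorms N hN).toFun (g • ⟨i, a⟩) ⟨j, b⟩ = 0 := if_neg h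
    have h2 : (ofGroupSeminorms N hN).toFun ⟨i, a⟩ ⟨j, b⟩ = 0 := if_neg h
    rw [h1, h2]
    simpa using hε.le

end InvariantKernel

/-! ### Density and exactness -/

theorem topDensity_le_topWeight {G : Type u} [Group G] [TopologicalSpace G] {I : Type u}
    (hI : #I ≤ topWeight G) {V : Type u} [NormedAddCommGroup V] [NormedSpace ℝ V]
    {p : (Σ _ : I, G) → V} (hp : Dense (Submodule.span ℝ (Set.range p) : Set V))
    (hc : ∀ i, Continuous fun a => p ⟨i, a⟩) : topDensity V ≤ topWeight G := by
  obtain ⟨D, hD, hcard⟩ := exists_dense_card_le_topWeight G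
  have hinf : ℵ₀ ≤ topWeight G := le_max_left _ _
  refine topDensity_le_of_dense_span hinf hp
    (D := Set.range fun q : I × D => p ⟨q.1, q.2⟩) ?_ ?_
  · rintro _ ⟨⟨i, a⟩, rfl⟩
    exact map_mem_closure (f := fun a => p ⟨i, a⟩) (hc i) (hD a) fun d hd => ⟨(i, ⟨d, hd⟩), rfl⟩
  · refine mk_range_le.trans ?_
    rw [Cardinal.mk_prod, Cardinal.lift_id, Cardinal.lift_id]
    exact (mul_le_mul' hI hcard).trans (Cardinal.mul_eq_self hinf).le

/-- The kernel values along an orbit are matrix coefficients of the action on the left space, so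
they are continuous for every topology on the group for which that action is. -/
theorem InvariantKernel.continuous_toFun_smul {G : Type u} [Group G] {S : Type u} [MulAction G S]
    {K : InvariantKernel G S} [TopologicalSpace G]
    (hc : Continuous fun p : G × K.LeftSpace => K.leftRep p.1 p.2) (s t : S) :
    Continuous fun g : G => K.toFun (g • s) t := by
  refine ((K.covec t).continuous.comp (hc.comp (Continuous.prodMk_left (K.leftVec s)))).congr
    fun g => ?_
  simp [leftRep_leftVec]

/-- If the kernel values along orbits detect the neighbourhoods of `1`, the action on the left
space alone already determines the topology. -/
theorem InvariantKernel.isTExact_birepresentation {G : Type u} [Group G] [TopologicalSpace G]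
    [IsTopologicalGroup G] [T2Space G] {S : Type u} [MulAction G S] {K : InvariantKernel G S}
    (hK : K.IsOrbitContinuous)
    (hU : ∀ U ∈ 𝓝 (1 : G), ∃ s, ∃ ε > 0, ∀ g : G, |K.toFun (g • s) s - K.toFun s s| < ε → g ∈ U) :
    K.birepresentation.IsTExact := by
  refine ⟨inferInstance, inferInstance,
    fun _ => ⟨hK.continuous_leftRep, hK.continuous_rightRep⟩, fun τ' hτ' hlt => ⟨(), fun hc => ?_⟩⟩
  refine hlt.ne (IsTopologicalGroup.ext inferInstance hτ' (le_antisymm (nhds_mono hlt.le) ?_))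
  intro U hUmem
  obtain ⟨s, ε, hε, h⟩ := hU U hUmem
  have hcont := @continuous_toFun_smul G _ S _ K τ' hc.1 s s
  have hmem := (Metric.tendsto_nhds.1 (@Continuous.tendsto _ _ τ' _ _ hcont 1)) ε hε
  rw [one_smul] at hmem
  exact Filter.mem_of_superset hmem fun g hg => h g hg

theorem theorem6p1 (G : Type u) [Group G] [TopologicalSpace G] [IsTopologicalGroup G]
    [T2Space G] :
    IsBRGroup G ∧
      ∃ Ψ : Birepresentation.{u, u} G,
        Ψ.IsTExact ∧
        IsStrongDuality Ψ.ω ∧ IsRegularForm Ψ.ω ∧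
        CompleteSpace Ψ.E ∧ CompleteSpace Ψ.F ∧
        topDensity Ψ.E ≤ topWeight G ∧ topDensity Ψ.F ≤ topWeight G := by
  suffices h : ∃ Ψ : Birepresentation.{u, u} G,
      Ψ.IsTExact ∧ IsStrongDuality Ψ.ω ∧ IsRegularForm Ψ.ω ∧ CompleteSpace Ψ.E ∧
      CompleteSpace Ψ.F ∧ topDensity Ψ.E ≤ topWeight G ∧ topDensity Ψ.F ≤ topWeight G by
    refine ⟨?_, h⟩
    obtain ⟨Ψ, ⟨h₁, h₂, h₃, h₄⟩, hΨ, -⟩ := h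
    exact ⟨PUnit, fun _ => Ψ, ⟨h₁, h₂, fun _ => h₃ (),
      fun τ' hτ' hlt => (h₄ τ' hτ' hlt).imp' (fun _ => PUnit.unit) fun _ h => h⟩, fun _ => hΨ⟩
  obtain ⟨B, hB, hcard⟩ := exists_basis_card_le_topWeight G
  let I := {U : B // (1 : G) ∈ U.1}
  have hIcard : #I ≤ topWeight G := (Cardinal.mk_subtype_le _).trans hcard
  choose N hN hNc hNU using fun i : I =>
    exists_groupSeminorm_subset_nhds_one ((hB.isOpen i.1.2).mem_nhds i.2)
  let K := InvariantKernel.ofGroupSeminorms N hN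
  have hK : K.IsOrbitContinuous := InvariantKernel.isOrbitContinuous_ofGroupSeminorms hN hNc
  refine ⟨K.birepresentation, InvariantKernel.isTExact_birepresentation hK fun U hU => ?_,
    K.isStrongDuality_form, K.isRegularForm_form,
    inferInstanceAs (CompleteSpace K.LeftSpace), inferInstanceAs (CompleteSpace K.RightSpace),
    topDensity_le_topWeight hIcard K.dense_span_leftVec fun i => ?_,
    topDensity_le_topWeight hIcard K.dense_span_rightVec fun i => ?_⟩
  · obtain ⟨W, hWB, hW, hWU⟩ := hB.mem_nhds_iff.1 hU
    obtain ⟨ε, hε, h⟩ := hNU ⟨⟨W, hWB⟩, hW⟩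
    refine ⟨⟨⟨⟨W, hWB⟩, hW⟩, 1⟩, ε, hε, fun g hg => hWU (h g ?_)⟩
    simpa [K, InvariantKernel.ofGroupSeminorms_mk_same, Sigma.smul_mk,
      abs_of_nonneg (apply_nonneg _ _)] using hg
  · refine (hK.continuous_leftRep.comp (Continuous.prodMk_left (K.leftVec ⟨i, 1⟩))).congr
      fun a => ?_
    simp [InvariantKernel.leftRep_leftVec]
  · refine (hK.continuous_rightRep.comp (Continuous.prodMk_left (K.rightVec ⟨i, 1⟩))).congr
      fun a => ?_
    simp [InvariantKernel.rightRep_rightVec]
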